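/- For an entire function $g$ and $r \ge 0$ write $M(r,g)=\max_{|z|=r}|g(z)|$ and $m(r,g)=\min_{|z|=r}|g(z)|$. Let $f^n$ denote the $n$-th iterate of $f$, and let $M^n(r,f)$ denote the $n$-th iterate of the function $r\mapsto M(r,f)$, evaluated at $r$. For $0<r_1<r_2$ let $A(r_1,r_2)=\{z\in\mathbb{C}: r_1<|z|<r_2\}$, and for $\zeta\in\mathbb{C}$ and real $\rho$ let $B(\zeta,\rho)=\{z\in\mathbb{C}:|z-\zeta|<\rho\}$ (empty if $\rho\le 0$). Suppose that $f$ is a transcendental entire function (that is, $f$ is entire and not a polynomial), and that $1<\lambda<\lambda'<\lambda''$. Then there exist $R'>0$ and a function $\epsilon:\mathbb{R}\to\mathbb{R}$, depending only on $f,\lambda,\lambda',\lambda''$, with $\epsilon(r)\to 0$ as $r\to\infty$, such that the following holds. If $r\ge R'$, $n\ge 1$ is an integer, $\eta\ge 0$, and there exists $s\in(\lambda r,\lambda' r)$ such that $m(s,f^n)\le\eta$, then there exists $w\in B(0,M^n(r,f))$ such that $$f^n(A(r,\lambda'' r))\supset B(0,M^n(r,f))\setminus B\bigl(w,\epsilon(r)\max\{|w|,\eta\}\bigr).$$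 -/

import Mathlib

/-- A transcendental entire function: holomorphic on the whole plane and not a polynomial. -/
def IsTranscendentalEntire (f : ℂ → ℂ) : Prop :=
  Differentiable ℂ f ∧ ¬ ∃ p : Polynomial ℂ, ∀ z, f z = p.eval z

/-- The maximum modulus `M(r, f) = max_{|z| = r} |f z|` (the supremum is attained when
`f` is continuous and `0 ≤ r`). Its `n`-fold iterate in `r` is `(maxModulus f)^[n]`. -/
noncomputable def maxModulus (f : ℂ → ℂ) (r : ℝ) : ℝ :=
  sSup ((fun z => ‖f z‖) '' Metric.sphere (0 : ℂ) r)

/-- The minimum modulus `m(r, f) = min_{|z| = r} |f z|` (the infimum is attained when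
`f` is continuous and `0 ≤ r`). -/
noncomputable def minModulus (f : ℂ → ℂ) (r : ℝ) : ℝ :=
  sInf ((fun z => ‖f z‖) '' Metric.sphere (0 : ℂ) r)

/-- The open annulus `A(r₁, r₂)` centred at the origin. -/
def openAnnulus (r₁ r₂ : ℝ) : Set ℂ :=
  {z | r₁ < ‖z‖ ∧ ‖z‖ < r₂}

/-! If the conclusion fails for g = f^n and a relative radius e, then g omits on the annulus two
values w₁, w₂ in B(0, M^n(r)) with |w₂ - w₁| ≥ e max(|w₁|, η). At a point z₀ of minimum modulus on
|z| = s, |g(z₀) - w₁| ≤ (2/e)|w₂ - w₁|. Schottky's theorem, applied to (g - w₁)/(w₂ - w₁) on a chain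
of discs around the circle, then bounds M(s, g) by a constant multiple of M^n(r), the constant
depending only on e and the three λ's (`exists_norm_le_on_circle`). On the other hand M(λr, f^n)
exceeds any prescribed multiple of M^n(r) for large r, uniformly in n
(`exists_mul_iterate_maxModulus_le`), a contradiction. Letting e tend to 0 slowly with r gives ε.
Schottky's theorem is proved from a weak Bloch theorem. -/

/-! ### Bloch's theorem -/

open Metric Set in
/-- Quantitative inverse function theorem: if `‖F'‖ ≤ 2 ‖F' a‖` on a disc about `a`, the image of
that disc contains a disc about `F a` of comparable size. -/
theorem ball_subset_image_of_norm_deriv_le {F : ℂ → ℂ} {a : ℂ} {t : ℝ} (ht : 0 < t)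
    (hF : DifferentiableOn ℂ F (ball a t)) (ha : deriv F a ≠ 0)
    (hb : ∀ z ∈ ball a t, ‖deriv F z‖ ≤ 2 * ‖deriv F a‖) :
    ball (F a) (t * ‖deriv F a‖ / 32) ⊆ F '' ball a t := by
  set m := ‖deriv F a‖ with hm
  have hm0 : 0 < m := norm_pos_iff.2 ha
  have hd : DifferentiableOn ℂ (deriv F) (ball a t) := hF.deriv isOpen_ball
  -- The Schwarz lemma keeps F' within 3m/8 of F'(a) on the disc of radius t/8, so F is close to its
  -- linear part there.
  have hmaps : MapsTo (deriv F) (ball a t) (closedBall (deriv F a) (3 * m)) := by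
    intro z hz
    rw [mem_closedBall, dist_eq_norm]
    linarith [norm_sub_le (deriv F z) (deriv F a), hb z hz]
  have hsub : closedBall a (t / 8) ⊆ ball a t := closedBall_subset_ball (by linarith)
  have hderiv : ∀ z ∈ closedBall a (t / 8), ‖deriv F z - deriv F a‖ ≤ m / 2 := by
    intro z hz
    have h1 := Complex.dist_le_div_mul_dist_of_mapsTo_ball hd hmaps (hsub hz)
    rw [dist_eq_norm] at h1
    have h2 : 3 * m / t * dist z a ≤ 3 * m / t * (t / 8) := by
      gcongr
      exact hz
    have h3 : 3 * m / t * (t / 8) = 3 * m / 8 := by field_simp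
    linarith
  have hlin : ∀ z ∈ closedBall a (t / 8),
      ‖(F z - deriv F a * z) - (F a - deriv F a * a)‖ ≤ m / 2 * ‖z - a‖ := by
    intro z hz
    refine (convex_closedBall a (t / 8)).norm_image_sub_le_of_norm_hasDerivWithin_le
      (f := fun z => F z - deriv F a * z) (f' := fun z => deriv F z - deriv F a) ?_ hderiv
      (mem_closedBall_self (by linarith)) hz
    intro x hx
    have h1 : HasDerivAt F (deriv F x) x :=
      (hF.differentiableAt (isOpen_ball.mem_nhds (hsub hx))).hasDerivAt
    have h2 : HasDerivAt (fun z => deriv F a * z) (deriv F a) x := by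
      simpa using (hasDerivAt_id x).const_mul (deriv F a)
    exact (h1.sub h2).hasDerivWithinAt
  have hlow : ∀ z ∈ closedBall a (t / 8), m / 2 * ‖z - a‖ ≤ ‖F z - F a‖ := by
    intro z hz
    have h1 := hlin z hz
    have h2 : deriv F a * (z - a) = (F z - F a) -
        ((F z - deriv F a * z) - (F a - deriv F a * a)) := by ring
    have h3 : m * ‖z - a‖ ≤ ‖F z - F a‖ +
        ‖(F z - deriv F a * z) - (F a - deriv F a * a)‖ := by
      rw [hm, ← norm_mul, h2]
      exact norm_sub_le _ _
    linarith
  have hcl : DiffContOnCl ℂ F (ball a (t / 8)) :=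
    DifferentiableOn.diffContOnCl (hF.mono (closure_ball_subset_closedBall.trans hsub))
  have key := hcl.ball_subset_image_closedBall (ε := t * m / 16) (by linarith) (fun z hz => by
      have h1 := hlow z (sphere_subset_closedBall hz)
      rw [mem_sphere, dist_eq_norm] at hz
      rw [hz] at h1
      linarith) (by
      refine Filter.Eventually.frequently (f := nhdsWithin a {a}ᶜ) ?_ |>.filter_mono
        nhdsWithin_le_nhds
      filter_upwards [self_mem_nhdsWithin, mem_nhdsWithin_of_mem_nhds
        (closedBall_mem_nhds a (show 0 < t / 8 by linarith))] with z hz hz' h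
      have h1 := hlow z hz'
      rw [h, sub_self, norm_zero] at h1
      have : 0 < ‖z - a‖ := norm_pos_iff.2 (sub_ne_zero.2 hz)
      nlinarith)
  have e : t * m / 16 / 2 = t * m / 32 := by ring
  rw [e] at key
  exact key.trans (image_mono hsub)

open Metric Set in
/-- A weak form of Bloch's theorem: if every disc of radius `ρ` meets the complement of the image
of `G`, then `G'` is bounded at the centre. -/
theorem norm_deriv_le_of_forall_exists_notMem_image {G : ℂ → ℂ} {c : ℂ} {R ρ : ℝ} (hR : 0 < R)
    (hG : DifferentiableOn ℂ G (ball c R))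
    (hρ : ∀ p, ∃ q ∈ ball p ρ, q ∉ G '' ball c R) :
    ‖deriv G c‖ ≤ 128 * ρ / R := by
  have hρ0 : 0 < ρ := by
    obtain ⟨q, hq, -⟩ := hρ 0
    exact pos_of_mem_ball hq
  rcases eq_or_ne (deriv G c) 0 with h0 | h0
  · rw [h0, norm_zero]; positivity
  have hsub : closedBall c (R / 2) ⊆ ball c R := closedBall_subset_ball (by linarith)
  -- Landau's trick: at a maximiser a of this weight, |G'| ≤ 2|G'(a)| on the disc about a of half
  -- the distance to the circle of radius R/2.
  have hcont : ContinuousOn (fun z => ‖deriv G z‖ * (R / 2 - dist z c)) (closedBall c (R / 2)) :=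
    (((hG.deriv isOpen_ball).continuousOn.mono hsub).norm).mul (by fun_prop)
  obtain ⟨a, ha, hmax⟩ := (isCompact_closedBall c (R / 2)).exists_isMaxOn
    ⟨c, mem_closedBall_self (by linarith)⟩ hcont
  have hc : ‖deriv G c‖ * (R / 2) ≤ ‖deriv G a‖ * (R / 2 - dist a c) := by
    simpa using hmax (mem_closedBall_self (show 0 ≤ R / 2 by linarith))
  have hpos : 0 < ‖deriv G a‖ * (R / 2 - dist a c) :=
    lt_of_lt_of_le (mul_pos (norm_pos_iff.2 h0) (by linarith)) hc
  have hda : deriv G a ≠ 0 := by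
    intro h
    simp [h] at hpos
  have ht : 0 < (R / 2 - dist a c) / 2 := by
    have := (pos_iff_pos_of_mul_pos hpos).1 (norm_pos_iff.2 hda)
    linarith
  set t := (R / 2 - dist a c) / 2 with htdef
  have hball : ∀ z ∈ ball a t, t ≤ R / 2 - dist z c := by
    intro z hz
    have := dist_triangle z a c
    rw [mem_ball] at hz
    linarith
  have hsub2 : ball a t ⊆ ball c R := fun z hz => by
    have := hball z hz
    rw [mem_ball]
    linarith
  have hb : ∀ z ∈ ball a t, ‖deriv G z‖ ≤ 2 * ‖deriv G a‖ := by
    intro z hz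
    have h1 := hball z hz
    have h2 : ‖deriv G z‖ * (R / 2 - dist z c) ≤ ‖deriv G a‖ * (R / 2 - dist a c) :=
      hmax (show z ∈ closedBall c (R / 2) by rw [mem_closedBall]; linarith)
    have h3 : ‖deriv G z‖ * t ≤ ‖deriv G z‖ * (R / 2 - dist z c) := by gcongr
    have h4 : R / 2 - dist a c = 2 * t := by rw [htdef]; ring
    rw [h4] at h2
    refine le_of_mul_le_mul_right (a := t) ?_ ht
    linarith
  have key := ball_subset_image_of_norm_deriv_le ht (hG.mono hsub2) hda hb
  obtain ⟨q, hq, hq'⟩ := hρ (G a)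
  have hle : t * ‖deriv G a‖ / 32 ≤ ρ := by
    by_contra! h
    exact hq' (image_mono hsub2 (key (ball_subset_ball h.le hq)))
  rw [le_div_iff₀ hR]
  have h4 : R / 2 - dist a c = 2 * t := by rw [htdef]; ring
  rw [h4] at hc
  linarith

-- The derivative bound holds at every point of the half disc, each being the centre of a disc of
-- radius R/2; integrate it along a segment.
open Metric Set in
theorem norm_sub_le_of_forall_exists_notMem_image {G : ℂ → ℂ} {c : ℂ} {R ρ : ℝ} (hR : 0 < R)
    (hG : DifferentiableOn ℂ G (ball c R))
    (hρ : ∀ p, ∃ q ∈ ball p ρ, q ∉ G '' ball c R) {z : ℂ} (hz : z ∈ ball c (R / 2)) :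
    ‖G z - G c‖ ≤ 128 * ρ := by
  have hρ0 : 0 < ρ := by
    obtain ⟨q, hq, -⟩ := hρ 0
    exact pos_of_mem_ball hq
  have hb : ∀ x ∈ ball c (R / 2), ‖deriv G x‖ ≤ 128 * ρ / (R / 2) := by
    intro x hx
    have hsub : ball x (R / 2) ⊆ ball c R := ball_subset_ball' (by
      rw [mem_ball] at hx; linarith)
    refine norm_deriv_le_of_forall_exists_notMem_image (by linarith) (hG.mono hsub) fun p => ?_
    obtain ⟨q, hq, hq'⟩ := hρ p
    exact ⟨q, hq, fun h => hq' (image_mono hsub h)⟩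
  have hsub : ball c (R / 2) ⊆ ball c R := ball_subset_ball (by linarith)
  have h1 := (convex_ball c (R / 2)).norm_image_sub_le_of_norm_deriv_le
    (fun x hx => hG.differentiableAt (isOpen_ball.mem_nhds (hsub hx))) hb
    (mem_ball_self (by linarith)) hz
  rw [mem_ball, dist_eq_norm] at hz
  calc ‖G z - G c‖ ≤ 128 * ρ / (R / 2) * ‖z - c‖ := h1
    _ ≤ 128 * ρ / (R / 2) * (R / 2) := by gcongr
    _ = 128 * ρ := by field_simp

/-! ### Schottky's theorem -/

open Metric in
/-- A zero-free holomorphic function on a disc has a holomorphic logarithm. -/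
theorem exists_exp_eq_of_ne_zero {h : ℂ → ℂ} {c : ℂ} {R : ℝ}
    (hd : DifferentiableOn ℂ h (ball c R)) (h0 : ∀ z ∈ ball c R, h z ≠ 0) :
    ∃ l : ℂ → ℂ, DifferentiableOn ℂ l (ball c R) ∧ ∀ z ∈ ball c R, Complex.exp (l z) = h z := by
  rcases le_or_gt R 0 with hR | hR
  · exact ⟨0, by simp [ball_eq_empty.2 hR], by simp [ball_eq_empty.2 hR]⟩
  have hq : DifferentiableOn ℂ (fun z => deriv h z / h z) (ball c R) :=
    (hd.deriv isOpen_ball).div hd h0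
  obtain ⟨l, hl0, hl⟩ := hq.isExactOn_ball.with_val_at c (Complex.log (h c))
  refine ⟨l, fun z hz => (hl z hz).differentiableAt.differentiableWithinAt, fun z hz => ?_⟩
  have hderiv : ∀ x ∈ ball c R, HasDerivAt (fun z => h z * Complex.exp (-l z)) 0 x := by
    intro x hx
    have h1 := (hd.differentiableAt (isOpen_ball.mem_nhds hx)).hasDerivAt
    refine (h1.mul (hl x hx).neg.cexp).congr_deriv ?_
    have := h0 x hx
    field_simp
    ring
  have hconst := (convex_ball c R).norm_image_sub_le_of_norm_hasDerivWithin_le (C := 0)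
    (fun x hx => (hderiv x hx).hasDerivWithinAt) (by simp) (mem_ball_self hR) hz
  have hcc : h c * Complex.exp (-l c) = 1 := by
    rw [hl0, Complex.exp_neg, Complex.exp_log (h0 c (mem_ball_self hR)),
      mul_inv_cancel₀ (h0 c (mem_ball_self hR))]
  rw [zero_mul, norm_le_zero_iff, sub_eq_zero, hcc, Complex.exp_neg] at hconst
  exact (eq_of_mul_inv_eq_one hconst).symm

/-- Follows from |cos(x + iy)|² = cos² x + sinh² y; it controls the imaginary part of an arccosine
at the centre of a disc. -/
theorem abs_im_le_norm_cos (v : ℂ) : |v.im| ≤ ‖Complex.cos v‖ := by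
  have h1 : Complex.normSq (Complex.cos v) = Real.cos v.re ^ 2 + Real.sinh v.im ^ 2 := by
    rw [Complex.cos_eq, Complex.normSq_apply]
    simp only [← Complex.ofReal_cos, ← Complex.ofReal_cosh, ← Complex.ofReal_sin,
      ← Complex.ofReal_sinh, Complex.sub_re, Complex.sub_im, Complex.mul_re, Complex.mul_im,
      Complex.ofReal_re, Complex.ofReal_im, Complex.I_re, Complex.I_im]
    ring_nf
    rw [Real.cosh_sq, Real.sin_sq]
    ring
  have h2 : |v.im| ≤ |Real.sinh v.im| := by
    rw [Real.abs_sinh]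
    exact Real.self_le_sinh_iff.2 (abs_nonneg _)
  refine h2.trans (abs_le_of_sq_le_sq ?_ (norm_nonneg _))
  rw [← Complex.normSq_eq_norm_sq, h1]
  nlinarith [sq_nonneg (Real.cos v.re)]

theorem norm_cos_le_exp (v : ℂ) : ‖Complex.cos v‖ ≤ Real.exp ‖v‖ := by
  have h1 : ‖Complex.exp (v * Complex.I)‖ ≤ Real.exp ‖v‖ := by
    simpa using Complex.norm_exp_le_exp_norm (v * Complex.I)
  have h2 : ‖Complex.exp (-v * Complex.I)‖ ≤ Real.exp ‖v‖ := by
    simpa using Complex.norm_exp_le_exp_norm (-v * Complex.I)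
  rw [Complex.cos, norm_div, Complex.norm_two, div_le_iff₀ two_pos]
  linarith [norm_add_le (Complex.exp (v * Complex.I)) (Complex.exp (-v * Complex.I))]

open Metric in
/-- A holomorphic function on a disc omitting `1` and `-1` is of the form `cos (π F)`, where `F` can
be chosen with controlled value at the centre. -/
theorem exists_cos_pi_mul_eq {h : ℂ → ℂ} {c : ℂ} {R : ℝ} (hR : 0 < R)
    (hd : DifferentiableOn ℂ h (ball c R)) (h1 : ∀ z ∈ ball c R, h z ≠ 1)
    (h2 : ∀ z ∈ ball c R, h z ≠ -1) :
    ∃ F : ℂ → ℂ, DifferentiableOn ℂ F (ball c R) ∧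
      (∀ z ∈ ball c R, Complex.cos (Real.pi * F z) = h z) ∧ ‖F c‖ ≤ 1 + ‖h c‖ := by
  have hsq : ∀ z ∈ ball c R, h z ^ 2 - 1 ≠ 0 := by
    intro z hz hh
    have : (h z - 1) * (h z + 1) = 0 := by linear_combination hh
    rcases mul_eq_zero.1 this with h | h
    · exact h1 z hz (sub_eq_zero.1 h)
    · exact h2 z hz (eq_neg_of_add_eq_zero_left h)
  -- An arccosine is -i log(h + √(h² - 1)); the sum is zero-free since its product with h - √(h² -
  -- 1) is 1.
  obtain ⟨l, hl, hle⟩ := exists_exp_eq_of_ne_zero (h := fun z => h z ^ 2 - 1) ((hd.pow 2).sub_const 1) hsq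
  have hq : ∀ z ∈ ball c R, Complex.exp (l z / 2) ^ 2 = h z ^ 2 - 1 := by
    intro z hz
    rw [← hle z hz, ← Complex.exp_nat_mul]
    congr 1
    push_cast
    ring
  have hdq : DifferentiableOn ℂ (fun z => h z + Complex.exp (l z / 2)) (ball c R) :=
    hd.add (hl.div_const 2).cexp
  have hne : ∀ z ∈ ball c R, h z + Complex.exp (l z / 2) ≠ 0 := by
    intro z hz h0
    have : (h z + Complex.exp (l z / 2)) * (h z - Complex.exp (l z / 2)) = 1 := by
      linear_combination -(hq z hz)
    rw [h0, zero_mul] at this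
    exact zero_ne_one this
  obtain ⟨k, hk, hke⟩ := exists_exp_eq_of_ne_zero hdq hne
  have hpi : (Real.pi : ℂ) ≠ 0 := by exact_mod_cast Real.pi_ne_zero
  have hcos : ∀ z ∈ ball c R, Complex.cos (-Complex.I * k z) = h z := by
    intro z hz
    have e1 : -Complex.I * k z * Complex.I = k z := by
      linear_combination (-k z) * Complex.I_mul_I
    have e2 : -(-Complex.I * k z) * Complex.I = -k z := by
      linear_combination (k z) * Complex.I_mul_I
    rw [Complex.cos, e1, e2, Complex.exp_neg, hke z hz, div_eq_iff two_ne_zero]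
    have := hne z hz
    field_simp
    linear_combination hq z hz
  set u := -Complex.I * k c / Real.pi with hu
  -- Subtracting the even integer 2N preserves cos(πF) and brings the real part at the centre into
  -- [-1, 1].
  set N : ℤ := round (u.re / 2) with hN
  refine ⟨fun z => -Complex.I * k z / Real.pi - 2 * N, ?_, fun z hz => ?_, ?_⟩
  · exact ((hk.const_mul _).div_const _).sub_const _
  · rw [← hcos z hz, ← Complex.cos_sub_int_mul_two_pi (-Complex.I * k z) N]
    congr 1
    field_simp
  · have hc := hcos c (mem_ball_self hR)
    have hre : |(u - 2 * N).re| ≤ 1 := by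
      have := abs_sub_round (u.re / 2)
      rw [← hN] at this
      simp only [Complex.sub_re, Complex.mul_re, Complex.re_ofNat, Complex.intCast_re,
        Complex.im_ofNat, Complex.intCast_im, mul_zero, sub_zero]
      rw [abs_le] at this ⊢
      constructor <;> linarith [this.1, this.2]
    have him : |(u - 2 * N).im| ≤ ‖h c‖ := by
      have e : (u - 2 * N).im = u.im := by simp
      have e2 : -Complex.I * k c = Real.pi * u := by rw [hu]; field_simp
      have h3 := abs_im_le_norm_cos (-Complex.I * k c)
      rw [hc, e2, Complex.im_ofReal_mul, abs_mul, abs_of_pos Real.pi_pos] at h3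
      rw [e]
      nlinarith [abs_nonneg u.im, Real.pi_gt_three]
    linarith [Complex.norm_le_abs_re_add_abs_im (u - 2 * N)]

/-- The points `m + i y` with `m ∈ ℤ` and `cosh (π y) ∈ ℤ` form a net in the plane. -/
theorem exists_cos_pi_mul_eq_int (p : ℂ) :
    ∃ q ∈ Metric.ball p 3, ∃ k : ℤ, Complex.cos (Real.pi * q) = k := by
  have hY : ∃ y : ℝ, |y - p.im| ≤ 1 ∧ ∃ n : ℤ, Real.cosh (Real.pi * y) = n := by
    have aux : ∀ Y : ℝ, 0 ≤ Y → ∃ y : ℝ, |y - Y| ≤ 1 ∧ ∃ n : ℤ, Real.cosh (Real.pi * y) = n := by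
      intro Y hY
      have hpi := Real.pi_gt_three
      have h1 : Real.cosh (Real.pi * Y) + 1 ≤ Real.cosh (Real.pi * (Y + 1)) := by
        rw [mul_add, mul_one, Real.cosh_add]
        have a1 : 2 ≤ Real.cosh Real.pi := by
          have b1 := Real.self_le_sinh_iff.2 Real.pi_pos.le
          have b2 := Real.sinh_lt_cosh Real.pi
          linarith
        have a2 := Real.one_le_cosh (Real.pi * Y)
        have a3 : 0 ≤ Real.sinh (Real.pi * Y) * Real.sinh Real.pi :=
          mul_nonneg (Real.sinh_nonneg_iff.2 (by positivity)) (Real.sinh_nonneg_iff.2 (by linarith))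
        nlinarith
      have h2 : ((⌈Real.cosh (Real.pi * Y)⌉ : ℤ) : ℝ) ∈
          Set.Icc (Real.cosh (Real.pi * Y)) (Real.cosh (Real.pi * (Y + 1))) :=
        ⟨Int.le_ceil _, (Int.ceil_lt_add_one _).le.trans h1⟩
      obtain ⟨y, hy, hye⟩ := intermediate_value_Icc (show Y ≤ Y + 1 by linarith)
        (f := fun y => Real.cosh (Real.pi * y)) (by fun_prop) h2
      exact ⟨y, by rw [abs_le]; constructor <;> linarith [hy.1, hy.2], _, hye⟩
    rcases le_total 0 p.im with h | h
    · exact aux _ h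
    · obtain ⟨y, hy, n, hn⟩ := aux (-p.im) (by linarith)
      refine ⟨-y, ?_, n, ?_⟩
      · rw [← abs_neg]; convert hy using 2; ring
      · rw [mul_neg, Real.cosh_neg, hn]
  obtain ⟨y, hy, n, hn⟩ := hY
  -- Only even real parts 2m are used, so that cos(π(2m + iy)) = cosh(πy) without a sign.
  set m : ℤ := round (p.re / 2) with hm
  refine ⟨y * Complex.I + m * 2, ?_, n, ?_⟩
  · rw [Metric.mem_ball, dist_eq_norm]
    have h1 := abs_sub_round (p.re / 2)
    rw [← hm] at h1
    have h2 := Complex.norm_le_abs_re_add_abs_im (y * Complex.I + m * 2 - p)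
    simp only [Complex.sub_re, Complex.add_re, Complex.mul_re, Complex.ofReal_re, Complex.I_re,
      mul_zero, Complex.ofReal_im, Complex.I_im, mul_one, sub_self, Complex.intCast_re,
      Complex.re_ofNat, Complex.intCast_im, Complex.im_ofNat, sub_zero, zero_add, Complex.sub_im,
      Complex.add_im, Complex.mul_im, add_zero, zero_mul] at h2
    have h3 : |(m : ℝ) * 2 - p.re| ≤ 1 := by
      rw [abs_le] at h1 ⊢
      constructor <;> linarith [h1.1, h1.2]
    linarith
  · have e : (Real.pi : ℂ) * (y * Complex.I + m * 2) =
        (Real.pi * y : ℝ) * Complex.I + m * (2 * Real.pi) := by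
      push_cast; ring
    rw [e, Complex.cos_add_int_mul_two_pi, Complex.cos_mul_I, ← Complex.ofReal_cosh, hn]
    simp

/-- The bound in Schottky's theorem. -/
noncomputable def schottkyBound (B : ℝ) : ℝ :=
  (1 + Real.exp (Real.pi * Real.exp (Real.pi * (387 + 2 * B)))) / 2

open Metric Set in
/-- **Schottky's theorem**. -/
theorem norm_le_schottkyBound {h : ℂ → ℂ} {c : ℂ} {R B : ℝ}
    (hd : DifferentiableOn ℂ h (ball c R)) (h0 : ∀ z ∈ ball c R, h z ≠ 0)
    (h1 : ∀ z ∈ ball c R, h z ≠ 1) (hB : ‖h c‖ ≤ B) {z : ℂ} (hz : z ∈ ball c (R / 2)) :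
    ‖h z‖ ≤ schottkyBound B := by
  have hR : 0 < R := by linarith [pos_of_mem_ball hz]
  have hzR : z ∈ ball c R := ball_subset_ball (by linarith) hz
  obtain ⟨F, hF, hFe, hFc⟩ := exists_cos_pi_mul_eq hR (h := fun z => 2 * h z - 1)
    ((hd.const_mul 2).sub_const 1)
    (fun z hz h => h1 z hz (by linear_combination h / 2))
    (fun z hz h => h0 z hz (by linear_combination h / 2))
  have hFint : ∀ z ∈ ball c R, ∀ k : ℤ, F z ≠ k := by
    intro z hz k hk
    have h2 := hFe z hz
    have hs : Complex.sin (Real.pi * F z) = 0 := by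
      rw [hk, mul_comm]; exact Complex.sin_int_mul_pi k
    have h3 := Complex.sin_sq_add_cos_sq (Real.pi * F z)
    rw [hs, h2] at h3
    have h4 : h z * (h z - 1) = 0 := by linear_combination h3 / 4
    rcases mul_eq_zero.1 h4 with h5 | h5
    · exact h0 z hz h5
    · exact h1 z hz (sub_eq_zero.1 h5)
  obtain ⟨G, hG, hGe, hGc⟩ := exists_cos_pi_mul_eq hR hF
    (fun z hz h => hFint z hz 1 (by simpa using h))
    (fun z hz h => hFint z hz (-1) (by simpa using h))
  -- F omits all integers, so G omits every q with cos(πq) an integer, and the Bloch bound applies.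
  -- The 387 below is 128·3 plus 3 from the two centre estimates.
  have hGz := norm_sub_le_of_forall_exists_notMem_image hR hG (ρ := 3) (fun p => by
    obtain ⟨q, hq, k, hk⟩ := exists_cos_pi_mul_eq_int p
    refine ⟨q, hq, ?_⟩
    rintro ⟨x, hx, rfl⟩
    exact hFint x hx k ((hGe x hx).symm.trans hk)) hz
  have n1 : ‖2 * h c - 1‖ ≤ 2 * B + 1 := by
    refine (norm_sub_le _ _).trans ?_
    rw [norm_mul, Complex.norm_two, norm_one]
    linarith
  have n2 : ‖G z‖ ≤ 387 + 2 * B := by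
    have := norm_sub_norm_le (G z) (G c)
    linarith
  have n3 : ‖F z‖ ≤ Real.exp (Real.pi * (387 + 2 * B)) := by
    rw [← hGe z hzR]
    refine (norm_cos_le_exp _).trans (Real.exp_le_exp.2 ?_)
    rw [norm_mul, Complex.norm_real, Real.norm_of_nonneg Real.pi_pos.le]
    gcongr
  have n4 : ‖2 * h z - 1‖ ≤ Real.exp (Real.pi * Real.exp (Real.pi * (387 + 2 * B))) := by
    rw [← hFe z hzR]
    refine (norm_cos_le_exp _).trans (Real.exp_le_exp.2 ?_)
    rw [norm_mul, Complex.norm_real, Real.norm_of_nonneg Real.pi_pos.le]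
    gcongr
  have n5 : ‖2 * h z‖ ≤ ‖2 * h z - 1‖ + 1 := by
    simpa using norm_add_le (2 * h z - 1) 1
  rw [norm_mul, Complex.norm_two] at n5
  rw [schottkyBound]
  linarith

open Metric in
/-- Schottky's theorem along a chain of discs. -/
theorem norm_le_iterate_schottkyBound {h : ℂ → ℂ} {γ : ℕ → ℂ} {d B : ℝ} {N : ℕ}
    (hd : ∀ k < N, DifferentiableOn ℂ h (ball (γ k) d))
    (h0 : ∀ k < N, ∀ z ∈ ball (γ k) d, h z ≠ 0) (h1 : ∀ k < N, ∀ z ∈ ball (γ k) d, h z ≠ 1)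
    (hγ : ∀ k < N, dist (γ (k + 1)) (γ k) < d / 2) (hB : ‖h (γ 0)‖ ≤ B) :
    ‖h (γ N)‖ ≤ schottkyBound^[N] B := by
  induction N with
  | zero => simpa using hB
  | succ N ih =>
    rw [Function.iterate_succ_apply']
    exact norm_le_schottkyBound (hd N N.lt_succ_self) (h0 N N.lt_succ_self) (h1 N N.lt_succ_self)
      (ih (fun k hk => hd k (by omega)) (fun k hk => h0 k (by omega)) (fun k hk => h1 k (by omega))
        (fun k hk => hγ k (by omega))) (hγ N N.lt_succ_self)

theorem iterate_schottkyBound_nonneg {B : ℝ} (hB : 0 ≤ B) (N : ℕ) : 0 ≤ schottkyBound^[N] B := by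
  cases N with
  | zero => exact hB
  | succ N =>
    rw [Function.iterate_succ_apply', schottkyBound]
    positivity

open Metric in
/-- Schottky's theorem along a chain of discs on which two given values are omitted. -/
theorem norm_le_of_chain_of_ne {g : ℂ → ℂ} (hg : Differentiable ℂ g) {w₁ w₂ : ℂ} (hw : w₁ ≠ w₂)
    {γ : ℕ → ℂ} {d B : ℝ} {N : ℕ} (h₁ : ∀ k < N, ∀ z ∈ ball (γ k) d, g z ≠ w₁)
    (h₂ : ∀ k < N, ∀ z ∈ ball (γ k) d, g z ≠ w₂)
    (hγ : ∀ k < N, dist (γ (k + 1)) (γ k) < d / 2) (hB : ‖g (γ 0) - w₁‖ ≤ B * ‖w₂ - w₁‖) :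
    ‖g (γ N)‖ ≤ ‖w₁‖ + schottkyBound^[N] B * ‖w₂ - w₁‖ := by
  have hne : w₂ - w₁ ≠ 0 := sub_ne_zero.2 hw.symm
  have hpos : 0 < ‖w₂ - w₁‖ := norm_pos_iff.2 hne
  have key := norm_le_iterate_schottkyBound (h := fun z => (g z - w₁) / (w₂ - w₁)) (γ := γ)
    (d := d) (B := B) (N := N)
    (fun k _ => ((hg.sub_const w₁).div_const (w₂ - w₁)).differentiableOn)
    (fun k hk z hz => div_ne_zero (sub_ne_zero.2 (h₁ k hk z hz)) hne)
    (fun k hk z hz h => h₂ k hk z hz (by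
      rw [div_eq_one_iff_eq hne] at h
      exact sub_left_inj.1 h)) hγ
    (by rw [norm_div, div_le_iff₀ hpos]; exact hB)
  rw [norm_div, div_le_iff₀ hpos] at key
  linarith [norm_sub_norm_le (g (γ N)) w₁]

/-! ### Growth of the maximum modulus -/

theorem norm_le_maxModulus {f : ℂ → ℂ} (hf : Continuous f) (z : ℂ) : ‖f z‖ ≤ maxModulus f ‖z‖ :=
  le_csSup ((isCompact_sphere 0 ‖z‖).image hf.norm).bddAbove ⟨z, by simp, rfl⟩

theorem exists_norm_eq_maxModulus {f : ℂ → ℂ} (hf : Continuous f) {r : ℝ} (hr : 0 ≤ r) :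
    ∃ z, ‖z‖ = r ∧ ‖f z‖ = maxModulus f r := by
  obtain ⟨z, hz, h⟩ := ((isCompact_sphere (0 : ℂ) r).image hf.norm).sSup_mem
    ((NormedSpace.sphere_nonempty.2 hr).image _)
  exact ⟨z, by simpa using hz, h⟩

theorem exists_norm_eq_minModulus {f : ℂ → ℂ} (hf : Continuous f) {r : ℝ} (hr : 0 ≤ r) :
    ∃ z, ‖z‖ = r ∧ ‖f z‖ = minModulus f r := by
  obtain ⟨z, hz, h⟩ := ((isCompact_sphere (0 : ℂ) r).image hf.norm).sInf_mem
    ((NormedSpace.sphere_nonempty.2 hr).image _)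
  exact ⟨z, by simpa using hz, h⟩

theorem norm_le_maxModulus_of_norm_le {f : ℂ → ℂ} (hf : Differentiable ℂ f) {z : ℂ} {r : ℝ}
    (hz : ‖z‖ ≤ r) : ‖f z‖ ≤ maxModulus f r := by
  rcases hz.eq_or_lt with rfl | h
  · exact norm_le_maxModulus hf.continuous z
  · refine Complex.norm_le_of_forall_mem_frontier_norm_le (U := Metric.ball 0 r)
      Metric.isBounded_ball hf.diffContOnCl (fun x hx => ?_) (subset_closure (by simpa using h))
    have hx' : ‖x‖ = r := by simpa using Metric.frontier_ball_subset_sphere hx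
    rw [← hx']
    exact norm_le_maxModulus hf.continuous x

theorem maxModulus_le_maxModulus {f : ℂ → ℂ} (hf : Differentiable ℂ f) {r s : ℝ} (hr : 0 ≤ r)
    (hrs : r ≤ s) : maxModulus f r ≤ maxModulus f s := by
  obtain ⟨z, hz, h⟩ := exists_norm_eq_maxModulus hf.continuous hr
  rw [← h]
  exact norm_le_maxModulus_of_norm_le hf (hz.trans_le hrs)

/-- Taylor expansion with an entire remainder factor q, to which the maximum principle can be
applied. -/
theorem exists_eq_polynomial_add_pow_mul {f : ℂ → ℂ} (hf : Differentiable ℂ f) (d : ℕ) :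
    ∃ (p : Polynomial ℂ) (q : ℂ → ℂ), p.natDegree ≤ d ∧ Differentiable ℂ q ∧
      ∀ z, f z = p.eval z + z ^ (d + 1) * q z := by
  have hds : ∀ g : ℂ → ℂ, Differentiable ℂ g → Differentiable ℂ (dslope g 0) := by
    intro g hg
    rw [← differentiableOn_univ] at hg ⊢
    exact (Complex.differentiableOn_dslope Filter.univ_mem).2 hg
  have hsp : ∀ (g : ℂ → ℂ) z, g z = g 0 + z * dslope g 0 z := by
    intro g z
    have := sub_smul_dslope g 0 z
    rw [sub_zero, smul_eq_mul] at this
    rw [this]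
    ring
  induction d with
  | zero =>
    exact ⟨Polynomial.C (f 0), dslope f 0, by simp, hds f hf, fun z => by simpa using hsp f z⟩
  | succ d ih =>
    obtain ⟨p, q, hp, hq, h⟩ := ih
    refine ⟨p + Polynomial.C (q 0) * Polynomial.X ^ (d + 1), dslope q 0, ?_, hds q hq, fun z => ?_⟩
    · exact (Polynomial.natDegree_add_le _ _).trans
        (max_le (by omega) (Polynomial.natDegree_C_mul_X_pow_le _ _))
    · rw [h z, hsp q z]
      simp
      ring

theorem Polynomial.exists_norm_eval_le {p : Polynomial ℂ} {d : ℕ} (hp : p.natDegree ≤ d) :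
    ∃ C, 0 ≤ C ∧ ∀ z : ℂ, 1 ≤ ‖z‖ → ‖p.eval z‖ ≤ C * ‖z‖ ^ d := by
  refine ⟨∑ i ∈ Finset.range (d + 1), ‖p.coeff i‖, by positivity, fun z hz => ?_⟩
  rw [Polynomial.eval_eq_sum_range' (Nat.lt_succ_of_le hp), Finset.sum_mul]
  refine (norm_sum_le _ _).trans (Finset.sum_le_sum fun i hi => ?_)
  rw [norm_mul, norm_pow]
  gcongr
  exact Nat.lt_succ_iff.1 (Finset.mem_range.1 hi)

/-- A transcendental entire function grows faster than any power. -/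
theorem IsTranscendentalEntire.exists_pow_le_maxModulus {f : ℂ → ℂ} (hf : IsTranscendentalEntire f)
    (d : ℕ) (K : ℝ) : ∃ R, ∀ t, R ≤ t → K * t ^ d ≤ maxModulus f t := by
  obtain ⟨p, q, hp, hq, h⟩ := exists_eq_polynomial_add_pow_mul hf.1 d
  obtain ⟨C, hC0, hC⟩ := Polynomial.exists_norm_eval_le hp
  obtain ⟨z₀, hz₀⟩ : ∃ z, q z ≠ 0 := by
    by_contra! h0
    exact hf.2 ⟨p, fun z => by rw [h z, h0 z, mul_zero, add_zero]⟩
  have hc : 0 < ‖q z₀‖ := norm_pos_iff.2 hz₀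
  refine ⟨max (max 1 ‖z₀‖) ((K + C) / ‖q z₀‖), fun t ht => ?_⟩
  have ht1 : 1 ≤ t := (le_max_left _ _).trans ((le_max_left _ _).trans ht)
  have ht2 : ‖z₀‖ ≤ t := (le_max_right _ _).trans ((le_max_left _ _).trans ht)
  have ht3 : K + C ≤ t * ‖q z₀‖ := (div_le_iff₀ hc).1 ((le_max_right _ _).trans ht)
  obtain ⟨z, hz, hzq⟩ := exists_norm_eq_maxModulus hq.continuous (zero_le_one.trans ht1)
  have h1 : ‖q z₀‖ ≤ ‖q z‖ := by
    rw [hzq]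
    exact norm_le_maxModulus_of_norm_le hq ht2
  have h2 : t ^ (d + 1) * ‖q z‖ ≤ maxModulus f t + C * t ^ d := by
    have e : z ^ (d + 1) * q z = f z - p.eval z := by rw [h z]; ring
    have := norm_sub_le (f z) (p.eval z)
    rw [← e, norm_mul, norm_pow] at this
    have h3 := hC z (hz ▸ ht1)
    have h4 := norm_le_maxModulus hf.1.continuous z
    rw [hz] at this h3 h4
    linarith
  have h3 : t ^ (d + 1) * ‖q z₀‖ ≤ t ^ (d + 1) * ‖q z‖ := by gcongr
  have h4 : (K + C) * t ^ d ≤ t * ‖q z₀‖ * t ^ d := by gcongr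
  rw [pow_succ] at h2 h3
  linarith

/-- For a transcendental entire function, `M(l t) / M(t) → ∞` for each `l > 1`. -/
theorem IsTranscendentalEntire.exists_mul_maxModulus_le {f : ℂ → ℂ} (hf : IsTranscendentalEntire f)
    {l : ℝ} (hl : 1 < l) (K : ℝ) :
    ∃ R, ∀ t, R ≤ t → K * maxModulus f t ≤ maxModulus f (l * t) := by
  obtain ⟨d, hd⟩ := pow_unbounded_of_one_lt (2 * K) hl
  obtain ⟨p, q, hp, hq, h⟩ := exists_eq_polynomial_add_pow_mul hf.1 d
  obtain ⟨C, hC0, hC⟩ := Polynomial.exists_norm_eval_le hp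
  -- The maximum principle for q gains the factor l^(d+1) > 2K up to polynomial errors. Failure of
  -- the claim would give M(t) ≤ 4C t^d.
  obtain ⟨R, hR⟩ := hf.exists_pow_le_maxModulus d (4 * C + 1)
  refine ⟨max 1 R, fun t ht => ?_⟩
  have ht1 : 1 ≤ t := (le_max_left _ _).trans ht
  have ht0 : 0 < t := by linarith
  have hl0 : 0 < l := by linarith
  have hlt : 1 ≤ l * t := by nlinarith
  have hlow := hR t ((le_max_right _ _).trans ht)
  by_contra! hcon
  obtain ⟨z, hz, hzf⟩ := exists_norm_eq_maxModulus hf.1.continuous ht0.le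
  obtain ⟨x, hx, hxq⟩ := exists_norm_eq_maxModulus hq.continuous (show 0 ≤ l * t by positivity)
  have hzx : ‖q z‖ ≤ ‖q x‖ := by
    rw [hxq]
    exact norm_le_maxModulus_of_norm_le hq (by rw [hz]; nlinarith)
  have h1 : maxModulus f t ≤ C * t ^ d + t ^ (d + 1) * ‖q x‖ := by
    rw [← hzf, h z]
    refine (norm_add_le _ _).trans (add_le_add ?_ ?_)
    · simpa [hz] using hC z (hz ▸ ht1)
    · rw [norm_mul, norm_pow, hz]
      gcongr
  have h2 : (l * t) ^ (d + 1) * ‖q x‖ ≤ maxModulus f (l * t) + C * (l * t) ^ d := by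
    have e : x ^ (d + 1) * q x = f x - p.eval x := by rw [h x]; ring
    have := norm_sub_le (f x) (p.eval x)
    rw [← e, norm_mul, norm_pow] at this
    have h3 := hC x (hx ▸ hlt)
    have h4 := norm_le_maxModulus hf.1.continuous x
    rw [hx] at this h3 h4
    linarith
  have hM0 : 0 ≤ maxModulus f t := hzf ▸ norm_nonneg _
  have hL : 0 < l ^ (d + 1) := by positivity
  have hLd : l ^ d ≤ l ^ (d + 1) := pow_le_pow_right₀ hl.le (Nat.le_succ d)
  have h3 : l ^ (d + 1) * (t ^ (d + 1) * ‖q x‖) ≤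
      l ^ (d + 1) * (maxModulus f t / 2) + l ^ (d + 1) * (C * t ^ d) := by
    have e1 : K * maxModulus f t ≤ l ^ (d + 1) * (maxModulus f t / 2) := by nlinarith
    have e2 : C * (l * t) ^ d ≤ l ^ (d + 1) * (C * t ^ d) := by
      rw [mul_pow]
      have : 0 ≤ C * t ^ d := by positivity
      nlinarith
    rw [mul_pow] at h2
    linarith
  rw [← mul_add] at h3
  have h4 := le_of_mul_le_mul_left h3 hL
  have : 0 < t ^ d := by positivity
  linarith

theorem IsTranscendentalEntire.exists_le_maxModulus {f : ℂ → ℂ} (hf : IsTranscendentalEntire f) :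
    ∃ R, ∀ t, R ≤ t → t ≤ maxModulus f t := by
  simpa using hf.exists_pow_le_maxModulus 1 1

/-! ### Maximum modulus of iterates -/

open Metric in
/-- The image of the disc `B(0, l r)` contains a circle of radius at least `l M(r)`. -/
theorem IsTranscendentalEntire.exists_circle_subset_image {f : ℂ → ℂ}
    (hf : IsTranscendentalEntire f) {l : ℝ} (hl : 1 < l) :
    ∃ R, ∀ r, R ≤ r → ∃ T, l * maxModulus f r ≤ T ∧
      ∀ w : ℂ, ‖w‖ = T → ∃ z, ‖z‖ < l * r ∧ f z = w := by
  -- With 1 < a < l, discs of radius (l - a)r along a radius of length ar stay in B(0, lr), while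
  -- M(ar)/M(r) is still large.
  set a := Real.sqrt l with ha
  have ha1 : 1 < a := Real.lt_sqrt_of_sq_lt (by linarith)
  have hal : a < l := by
    have := Real.mul_self_sqrt (show 0 ≤ l by linarith)
    rw [← ha] at this
    nlinarith
  obtain ⟨N, hN⟩ := exists_nat_gt (a / ((l - a) / 2))
  have hN0 : (0 : ℝ) < N := lt_of_le_of_lt (by
    have : 0 < l - a := by linarith
    positivity) hN
  rw [div_lt_iff₀ (by linarith)] at hN
  set Ψ := schottkyBound^[N] 2 with hΨ
  have hΨ0 : 0 ≤ Ψ := iterate_schottkyBound_nonneg (by norm_num) N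
  obtain ⟨R₁, hR₁⟩ := hf.exists_mul_maxModulus_le ha1 (l * (1 + 3 * Ψ) + 1)
  obtain ⟨R₂, hR₂⟩ := hf.exists_le_maxModulus
  refine ⟨max (max R₁ R₂) (max 1 ‖f 0‖), fun r hr => ?_⟩
  have hr₁ : R₁ ≤ r := (le_max_left _ _).trans ((le_max_left _ _).trans hr)
  have hr₂ : R₂ ≤ r := (le_max_right _ _).trans ((le_max_left _ _).trans hr)
  have hr₃ : 1 ≤ r := (le_max_left _ _).trans ((le_max_right _ _).trans hr)
  have hr₄ : ‖f 0‖ ≤ r := (le_max_right _ _).trans ((le_max_right _ _).trans hr)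
  have hM := hR₂ r hr₂
  set t := l * maxModulus f r with ht
  have hMt : maxModulus f r ≤ t := by nlinarith
  have ht0 : 0 < t := by linarith
  by_contra! hcon
  -- Omitted values on the circles of radii t and 2t are at distance between t and 3t, so Schottky
  -- from 0 bounds M(ar) by (1 + 3Ψ)t.
  obtain ⟨w₁, hw₁, ho₁⟩ := hcon t le_rfl
  obtain ⟨w₂, hw₂, ho₂⟩ := hcon (2 * t) (by linarith)
  obtain ⟨z, hz, hzf⟩ := exists_norm_eq_maxModulus hf.1.continuous (show 0 ≤ a * r by nlinarith)
  have hlow : t ≤ ‖w₂ - w₁‖ := by linarith [norm_sub_norm_le w₂ w₁]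
  have hup : ‖w₂ - w₁‖ ≤ 3 * t := by linarith [norm_sub_le w₂ w₁]
  have hball : ∀ k < N, ∀ x ∈ ball ((((k : ℝ) / N : ℝ) : ℂ) * z) ((l - a) * r), ‖x‖ < l * r := by
    intro k hk x hx
    have h1 : ‖(((k : ℝ) / N : ℝ) : ℂ) * z‖ ≤ a * r := by
      rw [norm_mul, hz, Complex.norm_real, Real.norm_of_nonneg (by positivity)]
      have : (k : ℝ) / N ≤ 1 := by
        rw [div_le_one hN0]
        exact_mod_cast hk.le
      exact mul_le_of_le_one_left (by nlinarith) this
    rw [mem_ball, dist_eq_norm] at hx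
    linarith [norm_sub_norm_le x ((((k : ℝ) / N : ℝ) : ℂ) * z)]
  have key := norm_le_of_chain_of_ne hf.1 (w₁ := w₁) (w₂ := w₂) (B := 2) (N := N)
    (γ := fun k => (((k : ℝ) / N : ℝ) : ℂ) * z) (d := (l - a) * r)
    (by rintro rfl; linarith)
    (fun k hk x hx => ho₁ x (hball k hk x hx)) (fun k hk x hx => ho₂ x (hball k hk x hx))
    (fun k hk => by
      rw [dist_eq_norm, ← sub_mul, ← Complex.ofReal_sub, norm_mul, hz, Complex.norm_real]
      have e : ((k + 1 : ℕ) : ℝ) / N - (k : ℝ) / N = 1 / N := by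
        push_cast; ring
      rw [e, Real.norm_of_nonneg (by positivity), one_div, inv_mul_lt_iff₀ hN0]
      nlinarith)
    (by
      simp only [Nat.cast_zero, zero_div, Complex.ofReal_zero, zero_mul]
      linarith [norm_sub_le (f 0) w₁])
  simp only [div_self hN0.ne', Complex.ofReal_one, one_mul] at key
  rw [hzf, hw₁, ← hΨ] at key
  have h5 := hR₁ r hr₁
  have h6 : Ψ * ‖w₂ - w₁‖ ≤ Ψ * (3 * t) := by gcongr
  have h7 : (l * (1 + 3 * Ψ) + 1) * maxModulus f r = t + Ψ * (3 * t) + maxModulus f r := by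
    rw [ht]; ring
  linarith

/-- Comparison of the maximum modulus of an iterate with the iterated maximum modulus. -/
theorem IsTranscendentalEntire.exists_mul_iterate_maxModulus_le {f : ℂ → ℂ}
    (hf : IsTranscendentalEntire f) {l : ℝ} (hl : 1 < l) (K : ℝ) :
    ∃ R, 0 < R ∧ ∀ n : ℕ, ∀ r, R ≤ r → R ≤ (maxModulus f)^[n + 1] r ∧
      K * (maxModulus f)^[n + 1] r ≤ maxModulus (f^[n + 1]) (l * r) := by
  obtain ⟨R₁, hR₁⟩ := hf.exists_circle_subset_image hl
  obtain ⟨R₂, hR₂⟩ := hf.exists_le_maxModulus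
  obtain ⟨R₃, hR₃⟩ := hf.exists_mul_maxModulus_le hl K
  refine ⟨max (max R₁ R₂) (max R₃ 1), by positivity, fun n => ?_⟩
  set R := max (max R₁ R₂) (max R₃ 1) with hR
  have hg : ∀ r, R ≤ r → R ≤ maxModulus f r := fun r hr =>
    hr.trans (hR₂ r (((le_max_right _ _).trans (le_max_left _ _)).trans hr))
  have hR1 : 1 ≤ R := (le_max_right _ _).trans (le_max_right _ _)
  induction n with
  | zero =>
    intro r hr
    simp only [zero_add, Function.iterate_one]
    exact ⟨hg r hr, hR₃ r (((le_max_left _ _).trans (le_max_right _ _)).trans hr)⟩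
  | succ n ih =>
    intro r hr
    rw [Function.iterate_succ_apply, Function.iterate_succ f (n + 1)]
    obtain ⟨h1, h2⟩ := ih _ (hg r hr)
    refine ⟨h1, h2.trans ?_⟩
    -- The covered circle has radius T ≥ l M(r), so the same factor l is available at every step of
    -- the induction.
    obtain ⟨T, hT, hTc⟩ := hR₁ r (((le_max_left _ _).trans (le_max_left _ _)).trans hr)
    have hM0 : 0 ≤ l * maxModulus f r := by nlinarith [hg r hr]
    refine (maxModulus_le_maxModulus (hf.1.iterate (n + 1)) hM0 hT).trans ?_
    obtain ⟨w, hw, hwe⟩ :=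
      exists_norm_eq_maxModulus (hf.1.iterate (n + 1)).continuous (hM0.trans hT)
    obtain ⟨z, hz, rfl⟩ := hTc w hw
    rw [← hwe]
    exact norm_le_maxModulus_of_norm_le (f := f^[n + 1] ∘ f)
      ((hf.1.iterate (n + 1)).comp hf.1) hz.le

/-! ### Covering by the image of an annulus -/

open Metric in
/-- Schottky's theorem along a circle in an annulus, for functions omitting two values. -/
theorem exists_norm_le_on_circle {l l' l'' : ℝ} (h₁ : 1 < l) (h₂ : l < l') (h₃ : l' < l'') {B : ℝ}
    (hB : 0 ≤ B) :
    ∃ Ψ : ℝ, 0 ≤ Ψ ∧ ∀ r : ℝ, 0 < r → ∀ g : ℂ → ℂ, Differentiable ℂ g → ∀ w₁ w₂ : ℂ, w₁ ≠ w₂ →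
      w₁ ∉ g '' openAnnulus r (l'' * r) → w₂ ∉ g '' openAnnulus r (l'' * r) →
      ∀ z₀ : ℂ, ‖z₀‖ ∈ Set.Ioo (l * r) (l' * r) → ‖g z₀ - w₁‖ ≤ B * ‖w₂ - w₁‖ →
      ∀ z : ℂ, ‖z‖ = ‖z₀‖ → ‖g z‖ ≤ ‖w₁‖ + Ψ * ‖w₂ - w₁‖ := by
  -- Discs of radius δr centred on the circle through z₀ stay in the annulus; by scaling, their
  -- number N depends on neither r nor g.
  set δ := min (l - 1) (l'' - l') with hδ
  have hδ0 : 0 < δ := lt_min (by linarith) (by linarith)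
  obtain ⟨N, hN⟩ := exists_nat_gt (l' * Real.pi / (δ / 2))
  have hN0 : (0 : ℝ) < N := lt_of_le_of_lt (by
    have : 0 < l' := by linarith
    positivity) hN
  rw [div_lt_iff₀ (by linarith)] at hN
  refine ⟨schottkyBound^[N] B, iterate_schottkyBound_nonneg hB N, ?_⟩
  intro r hr g hg w₁ w₂ hw ho₁ ho₂ z₀ hz₀ hgz z hz
  have hz₀pos : 0 < ‖z₀‖ := lt_trans (by nlinarith) hz₀.1
  have hz₀ne : z₀ ≠ 0 := norm_pos_iff.1 hz₀pos
  set θ := (z / z₀).arg with hθ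
  have hzθ : z = z₀ * Complex.exp (θ * Complex.I) := by
    have := Complex.norm_mul_exp_arg_mul_I (z / z₀)
    rw [norm_div, hz, div_self hz₀pos.ne', Complex.ofReal_one, one_mul, ← hθ] at this
    rw [this]
    field_simp
  set γ : ℕ → ℂ := fun k => z₀ * Complex.exp ((θ * k / N : ℝ) * Complex.I) with hγ
  have hγn : ∀ k, ‖γ k‖ = ‖z₀‖ := fun k => by
    simp only [hγ, norm_mul, Complex.norm_exp_ofReal_mul_I, mul_one]
  have hball : ∀ k, ∀ x ∈ ball (γ k) (δ * r), x ∈ openAnnulus r (l'' * r) := by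
    intro k x hx
    rw [mem_ball, dist_eq_norm] at hx
    have a1 := norm_sub_norm_le x (γ k)
    have a2 := norm_sub_norm_le (γ k) x
    rw [norm_sub_rev] at a2
    rw [hγn] at a1 a2
    have b1 : δ * r ≤ (l - 1) * r := by gcongr; exact min_le_left _ _
    have b2 : δ * r ≤ (l'' - l') * r := by gcongr; exact min_le_right _ _
    exact ⟨by linarith [hz₀.1], by linarith [hz₀.2]⟩
  have key := norm_le_of_chain_of_ne hg hw (γ := γ) (d := δ * r) (B := B) (N := N)
    (fun k _ x hx h => ho₁ ⟨x, hball k x hx, h⟩) (fun k _ x hx h => ho₂ ⟨x, hball k x hx, h⟩)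
    (fun k _ => by
      have e : γ (k + 1) - γ k = γ k * (Complex.exp (Complex.I * (θ / N : ℝ)) - 1) := by
        simp only [hγ]
        rw [mul_sub, mul_one, mul_assoc, ← Complex.exp_add]
        congr 3
        push_cast
        ring
      rw [dist_eq_norm, e, norm_mul, hγn]
      have a1 := Real.norm_exp_I_mul_ofReal_sub_one_le (x := θ / N)
      have a2 : ‖θ / N‖ ≤ Real.pi / N := by
        rw [norm_div, Real.norm_of_nonneg hN0.le, Real.norm_eq_abs]
        gcongr
        exact Complex.abs_arg_le_pi _
      calc _ ≤ ‖z₀‖ * (Real.pi / N) := by gcongr; exact a1.trans a2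
        _ ≤ (l' * r) * (Real.pi / N) := by
          have : 0 ≤ Real.pi / N := by positivity
          gcongr
          exact hz₀.2.le
        _ < δ * r / 2 := by
          rw [← mul_div_assoc, div_lt_iff₀ hN0]
          nlinarith)
    (by simpa [hγ] using hgz)
  have hlast : γ N = z := by
    simp only [hγ]
    rw [mul_div_assoc, div_self hN0.ne', mul_one, hzθ]
  rwa [hlast] at key

/-- The covering property with a fixed relative radius of the exceptional disc. -/
theorem IsTranscendentalEntire.exists_ball_diff_ball_subset_image {f : ℂ → ℂ}
    (hf : IsTranscendentalEntire f) {l l' l'' : ℝ} (h₁ : 1 < l) (h₂ : l < l') (h₃ : l' < l'')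
    {e : ℝ} (he : 0 < e) :
    ∃ R : ℝ, ∀ r : ℝ, R ≤ r → ∀ n : ℕ, 1 ≤ n → ∀ η : ℝ, 0 ≤ η →
      (∃ s ∈ Set.Ioo (l * r) (l' * r), minModulus (f^[n]) s ≤ η) →
      ∃ w ∈ Metric.ball (0 : ℂ) ((maxModulus f)^[n] r),
        Metric.ball (0 : ℂ) ((maxModulus f)^[n] r) \ Metric.ball w (e * max ‖w‖ η) ⊆
          f^[n] '' openAnnulus r (l'' * r) := by
  obtain ⟨Ψ, hΨ0, hΨ⟩ := exists_norm_le_on_circle h₁ h₂ h₃ (B := 2 / e) (by positivity)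
  obtain ⟨R, hR0, hR⟩ := hf.exists_mul_iterate_maxModulus_le h₁ (2 + 2 * Ψ)
  refine ⟨R, fun r hr n hn η hη ⟨s, hs, hsη⟩ => ?_⟩
  obtain ⟨n, rfl⟩ : ∃ m, n = m + 1 := ⟨n - 1, by omega⟩
  obtain ⟨hM, hgrow⟩ := hR n r hr
  have hr0 : 0 < r := hR0.trans_le hr
  set g := f^[n + 1] with hg
  set M := (maxModulus f)^[n + 1] r with hMdef
  have hM0 : 0 < M := hR0.trans_le hM
  have hgd : Differentiable ℂ g := hf.1.iterate (n + 1)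
  have hlr : 0 < l * r := by positivity
  have hs0 : 0 ≤ s := (hlr.trans hs.1).le
  obtain ⟨z₀, hz₀, hz₀m⟩ := exists_norm_eq_minModulus hgd.continuous hs0
  rw [← hz₀m] at hsη
  by_contra! hcon
  have hex : ∃ w₁ ∈ Metric.ball (0 : ℂ) M, w₁ ∉ g '' openAnnulus r (l'' * r) := by
    obtain ⟨w, hw, hw'⟩ := Set.not_subset.1 (hcon 0 (Metric.mem_ball_self hM0))
    exact ⟨w, hw.1, hw'⟩
  obtain ⟨w₁, hw₁, ho₁⟩ := hex
  obtain ⟨w₂, ⟨hw₂, hfar⟩, ho₂⟩ := Set.not_subset.1 (hcon w₁ hw₁)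
  rw [mem_ball_zero_iff] at hw₁ hw₂
  rw [Metric.mem_ball, dist_eq_norm, not_lt] at hfar
  -- Otherwise w₁ = 0 = g(z₀), although w₁ is omitted. This makes w₁ and w₂ distinct.
  have hmax : 0 < max ‖w₁‖ η := by
    by_contra! h
    have a1 : ‖w₁‖ ≤ 0 := (le_max_left _ _).trans h
    have a2 : η ≤ 0 := (le_max_right _ _).trans h
    refine ho₁ ⟨z₀, ⟨?_, ?_⟩, ?_⟩
    · nlinarith [hs.1]
    · nlinarith [hs.2]
    · rw [norm_le_zero_iff.1 a1, norm_le_zero_iff.1 (hsη.trans a2)]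
  have hdist : 0 < ‖w₂ - w₁‖ := lt_of_lt_of_le (by positivity) hfar
  have hB : ‖g z₀ - w₁‖ ≤ 2 / e * ‖w₂ - w₁‖ := by
    have a1 := norm_sub_le (g z₀) w₁
    have a2 := le_max_left ‖w₁‖ η
    have a3 := le_max_right ‖w₁‖ η
    rw [div_mul_eq_mul_div, le_div_iff₀ he]
    nlinarith
  obtain ⟨z, hz, hzM⟩ := exists_norm_eq_maxModulus hgd.continuous hs0
  have key := hΨ r hr0 g hgd w₁ w₂ (by rintro rfl; simp at hdist) ho₁ ho₂ z₀ (hz₀ ▸ hs) hB z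
    (hz.trans hz₀.symm)
  have hmono := maxModulus_le_maxModulus hgd hlr.le hs.1.le
  have hup : Ψ * ‖w₂ - w₁‖ ≤ Ψ * (2 * M) := by
    gcongr
    linarith [norm_sub_le w₂ w₁]
  rw [hzM] at key
  linarith

theorem theorem2p1 (f : ℂ → ℂ) (hf : IsTranscendentalEntire f)
    (lam lam' lam'' : ℝ) (h₁ : 1 < lam) (h₂ : lam < lam') (h₃ : lam' < lam'') :
    ∃ R' : ℝ, 0 < R' ∧ ∃ ε : ℝ → ℝ,
      Filter.Tendsto ε Filter.atTop (nhds 0) ∧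
      ∀ r : ℝ, R' ≤ r → ∀ n : ℕ, 1 ≤ n → ∀ η : ℝ, 0 ≤ η →
        (∃ s ∈ Set.Ioo (lam * r) (lam' * r), minModulus (f^[n]) s ≤ η) →
        ∃ w ∈ Metric.ball (0 : ℂ) ((maxModulus f)^[n] r),
          Metric.ball (0 : ℂ) ((maxModulus f)^[n] r) \ Metric.ball w (ε r * max ‖w‖ η) ⊆
            f^[n] '' openAnnulus r (lam'' * r) := by
  choose R hR using fun k : ℕ =>
    hf.exists_ball_diff_ball_subset_image h₁ h₂ h₃ (Nat.one_div_pos_of_nat (α := ℝ) (n := k))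
  classical
  -- The largest k ≤ r whose threshold r has passed. The default value 0 is legitimate because r ≥ R
  -- 0.
  set κ : ℝ → ℕ := fun r => Nat.findGreatest (fun k => R k ≤ r) ⌊r⌋₊ with hκ
  refine ⟨max (R 0) 1, by positivity, fun r => 1 / ((κ r : ℝ) + 1), ?_, fun r hr => ?_⟩
  · refine tendsto_one_div_add_atTop_nhds_zero_nat.comp (Filter.tendsto_atTop.2 fun k => ?_)
    filter_upwards [Filter.eventually_ge_atTop (R k), Filter.eventually_ge_atTop (k : ℝ)]
      with r hr hk
    exact Nat.le_findGreatest (Nat.le_floor hk) hr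
  · exact hR (κ r) r (Nat.findGreatest_spec (P := fun k => R k ≤ r) (Nat.zero_le _)
      ((le_max_left _ _).trans hr))
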